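/- Let $N\ge 1$, $Q=(0,1)^N$, and let $k\ge 0$ be an integer. For $s\in(0,1)$ and $w:(0,1)\to\mathbb R$ let $$d^s_R w(x)=-\frac1{\Gamma(1-s)}\frac{d}{dx}\int_x^1\frac{w(t)}{(t-x)^s}\,dt$$ be the right-sided Riemann–Liouville derivative, let $\partial^s_{i,R}$ be this operator acting in the variable $x_i$, and for a vector field $\psi$ on $Q$ put $\operatorname{div}^s\psi=\big[(1-\tfrac1N)s+\tfrac1N\big]\sum_{i=1}^N\partial^s_{i,R}\psi_i$. For $\varphi\in C_c^\infty(Q;\mathbb R^{N\times N^k})$ let $\operatorname{div}^k\varphi$ be the vector field $(\operatorname{div}^k\varphi)_i=\sum_{j_1,\dots,j_k=1}^N\partial_{j_1}\cdots\partial_{j_k}\varphi_{i,(j_1,\dots,j_k)}$ (so $\operatorname{div}^0\varphi=\varphi$). For $p\in[1,\infty]$ and $u\in L^1(Q)$ define $$TV^{k+s}_{\ell^p}(u)=\sup\Big\{\int_Q u\,\operatorname{div}^s[\operatorname{div}^k\varphi]\,dx:\ \varphi\in C_c^\infty(Q;\mathbb R^{N\times N^k}),\ |\varphi|^*_{\ell^p}\le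 1\text{ on }Q\Big\}\in[0,\infty],$$ where $|\cdot|^*_{\ell^p}$ is the norm dual to the entrywise $\ell^p$ norm. Let $SV^{k+s}(Q)$ be the set of all $u\in L^1(Q)$ such that, for every $p\in[1,\infty]$, $TV^{k+s}_{\ell^p}(u)<\infty$ and there are $u_n\in C^\infty(Q)\cap L^1(Q)$ with $TV^{k+s}_{\ell^p}(u_n)<\infty$, $u_n\to u$ in $L^1(Q)$ and $TV^{k+s}_{\ell^p}(u_n)\to TV^{k+s}_{\ell^p}(u)$. Then there is a constant $C>0$, depending only on $N$ and $k$, such that for all $p\in[1,\infty]$, all $s\in(0,1)$ and all $u\in SV^{k+s}(Q)$, $$TV^{s}_{\ell^p}(u)\le C\big(\|u\|_{L^1(Q)}+TV^{k+s}_{\ell^p}(u)\big).$$ -/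

import Mathlib

open MeasureTheory Filter Topology Set
open scoped ENNReal ContDiff

noncomputable section

namespace FracTV

/-- The open unit cube `Q = (0,1)^N`. -/
def unitCube (N : ℕ) : Set (Fin N → ℝ) := {x | ∀ i, x i ∈ Ioo (0 : ℝ) 1}

/-- The right-sided Riemann-Liouville derivative of order `s ∈ (0,1)` on the unit interval:
`d_R^s w (x) = - 1 / Γ(1-s) * d/dx ∫_x^1 w(t) / (t-x)^s dt`. -/
def rlDerivRight (s : ℝ) (w : ℝ → ℝ) (x : ℝ) : ℝ :=
  -(1 / Real.Gamma (1 - s)) * deriv (fun y : ℝ => ∫ t in y..1, w t / (t - y) ^ s) x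

/-- The partial derivative `∂_i f`. -/
def partialDeriv {N : ℕ} (i : Fin N) (f : (Fin N → ℝ) → ℝ) (x : Fin N → ℝ) : ℝ :=
  deriv (fun t : ℝ => f (Function.update x i t)) (x i)

/-- The right-sided fractional partial derivative `∂_{i,R}^s f`: the one-dimensional derivative of
order `s` in the `i`-th variable, the other variables being frozen. -/
def fracPartialDerivRight {N : ℕ} (s : ℝ) (i : Fin N) (f : (Fin N → ℝ) → ℝ)
    (x : Fin N → ℝ) : ℝ :=
  rlDerivRight s (fun t : ℝ => f (Function.update x i t)) (x i)

/-- The scaled fractional divergence of a vector field,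
`div^s φ = [(1 - 1/N) s + 1/N] ∑ i, ∂_{i,R}^s φ_i`. -/
def fracDiv {N : ℕ} (s : ℝ) (φ : (Fin N → ℝ) → Fin N → ℝ) (x : Fin N → ℝ) : ℝ :=
  ((1 - 1 / (N : ℝ)) * s + 1 / (N : ℝ)) *
    ∑ i, fracPartialDerivRight s i (fun y => φ y i) x

/-- Indices of the entries of an `N × N^k` matrix (a tensor of order `k + 1`). -/
abbrev TensorIndex (N k : ℕ) : Type := Fin N × (Fin k → Fin N)

/-- The iterated divergence `div^k`, which turns a field of `N × N^k` matrices into a vector field: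
each step is the row-wise divergence, that is, it contracts the last index with the gradient.
Explicitly, `(div^k φ)_i = ∑_j ∂_{j_1} ⋯ ∂_{j_k} φ_{i, (j_1, …, j_k)}`. -/
def divIter {N : ℕ} : (k : ℕ) → ((Fin N → ℝ) → TensorIndex N k → ℝ) → (Fin N → ℝ) → Fin N → ℝ
  | 0, φ => fun x i => φ x (i, Fin.elim0)
  | k + 1, φ => divIter k (fun x a =>
      ∑ l : Fin N, partialDeriv l (fun y => φ y (a.1, (Fin.snoc a.2 l : Fin (k + 1) → Fin N))) x)

/-- The norm dual to the `ℓ^p` norm on `ℝ^ι`, with respect to the Euclidean pairing. -/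
def dualNorm {ι : Type} [Fintype ι] (p : ℝ≥0∞) [Fact (1 ≤ p)] (y : ι → ℝ) : ℝ :=
  sSup ((fun x : PiLp p (fun _ : ι => ℝ) => ∑ i, x i * y i) '' Metric.closedBall 0 1)

/-- The test fields: `φ ∈ C_c^∞(Q; M^{N × N^k})` whose dual `ℓ^p` norm is at most `1` everywhere. -/
def IsTestField {N : ℕ} (p : ℝ≥0∞) [Fact (1 ≤ p)] (k : ℕ)
    (φ : (Fin N → ℝ) → TensorIndex N k → ℝ) : Prop :=
  ContDiff ℝ ∞ φ ∧ HasCompactSupport φ ∧ tsupport φ ⊆ unitCube N ∧ ∀ x, dualNorm p (φ x) ≤ 1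

/-- The total variation `TV^r_{ℓ^p}(u)` of order `r = k + s` with `k = ⌊r⌋` and `s ∈ (0,1)`,
the supremum of `∫_Q u div^s (div^k φ) dx` over all test fields `φ`. As `φ = 0` is a test field,
the supremum is nonnegative, so replacing negative integrals by `0` does not change it. -/
def TV {N : ℕ} (p : ℝ≥0∞) [Fact (1 ≤ p)] (k : ℕ) (s : ℝ) (u : (Fin N → ℝ) → ℝ) : ℝ≥0∞ :=
  ⨆ (φ : (Fin N → ℝ) → TensorIndex N k → ℝ) (_ : IsTestField p k φ),
    ENNReal.ofReal (∫ x in unitCube N, u x * fracDiv s (divIter k φ) x)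

/-- Strict convergence `v n → u` with respect to the seminorm `TV^{k+s}_{ℓ^p}`: convergence in
`L^1(Q)` together with convergence of the (finite) total variations. -/
def StrictConv {N : ℕ} (p : ℝ≥0∞) [Fact (1 ≤ p)] (k : ℕ) (s : ℝ)
    (v : ℕ → (Fin N → ℝ) → ℝ) (u : (Fin N → ℝ) → ℝ) : Prop :=
  (∀ n, IntegrableOn (v n) (unitCube N) ∧ TV p k s (v n) < ⊤) ∧
  IntegrableOn u (unitCube N) ∧ TV p k s u < ⊤ ∧
  Tendsto (fun n => ∫ x in unitCube N, |v n x - u x|) atTop (𝓝 0) ∧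
  Tendsto (fun n => TV p k s (v n)) atTop (𝓝 (TV p k s u))

/-- Membership in `SV^{k+s}(Q)`, the intersection over all `p ∈ [1,∞]` of the closures of
`C^∞(Q)` with respect to strict convergence. -/
def MemSV {N : ℕ} (k : ℕ) (s : ℝ) (u : (Fin N → ℝ) → ℝ) : Prop :=
  ∀ (p : ℝ≥0∞) [Fact (1 ≤ p)], ∃ v : ℕ → (Fin N → ℝ) → ℝ,
    (∀ n, ContDiffOn ℝ ∞ (v n) (unitCube N)) ∧ StrictConv p k s v u

end FracTV

end

/-!
Each component of a test field `ψ` of order `0` can be written as `ψ_i = ∂_i^k φ_i + η_i` with `φ_i`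
and `∂_i η_i` bounded by a multiple of `sup |ψ|`: subtract from `ψ_i` its line means in the
direction `i`, spread along a fixed bump, so that the antiderivative of the rest in `x_i` is again
compactly supported, and iterate. Putting the `φ_i` on the diagonal of a tensor field gives, up to
scaling, a test field of order `k` whose `div^k` is `(∂_i^k φ_i)_i`. The remainder is harmless,
because `∂^s_{i,R}` of a function vanishing for `x_i` near `1` is minus the fractional integral of
order `1 - s` of its derivative `∂_i`, so that
`|∂^s_{i,R} η_i| ≤ sup |∂_i η_i| / Γ(2 - s) ≤ 2 sup |∂_i η_i|` uniformly in `s`.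
-/

open scoped Convolution

namespace FracTV

variable {N : ℕ}

section PartialDeriv

variable {f g : (Fin N → ℝ) → ℝ} {i : Fin N}

theorem hasDerivAt_comp_update {x : Fin N → ℝ} {t : ℝ}
    (hf : DifferentiableAt ℝ f (Function.update x i t)) :
    HasDerivAt (fun τ => f (Function.update x i τ))
      (partialDeriv i f (Function.update x i t)) t := by
  have h := (hf.hasFDerivAt.comp_hasDerivAt t (hasDerivAt_update x i t)).differentiableAt.hasDerivAt
  simpa [partialDeriv, Function.comp_def] using h

theorem partialDeriv_eq_fderiv {x : Fin N → ℝ} (hf : DifferentiableAt ℝ f x) :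
    partialDeriv i f x = fderiv ℝ f x (Pi.single i 1) := by
  have h := hf.hasFDerivAt
  rw [← Function.update_eq_self i x] at h
  have hderiv := (h.comp_hasDerivAt (x i) (hasDerivAt_update x i (x i))).deriv
  rwa [Function.update_eq_self] at hderiv

theorem contDiff_partialDeriv (hf : ContDiff ℝ ∞ f) : ContDiff ℝ ∞ (partialDeriv i f) := by
  have h : partialDeriv i f = fun x => fderiv ℝ f x (Pi.single i 1) :=
    funext fun x => partialDeriv_eq_fderiv (hf.differentiable (by simp) x)
  rw [h]
  exact (hf.fderiv_right (by simp)).clm_apply contDiff_const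

theorem partialDeriv_add (hf : Differentiable ℝ f) (hg : Differentiable ℝ g) :
    partialDeriv i (f + g) = partialDeriv i f + partialDeriv i g := by
  ext x
  simp only [Pi.add_apply, partialDeriv_eq_fderiv (hf x), partialDeriv_eq_fderiv (hg x),
    partialDeriv_eq_fderiv ((hf.add hg) x), fderiv_add (hf x) (hg x), add_apply]

theorem iterate_partialDeriv_add (hf : ContDiff ℝ ∞ f) (hg : ContDiff ℝ ∞ g) (k : ℕ) :
    (partialDeriv i)^[k] (f + g) = (partialDeriv i)^[k] f + (partialDeriv i)^[k] g := by
  induction k generalizing f g with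
  | zero => rfl
  | succ k ih =>
    simp only [Function.iterate_succ_apply,
      partialDeriv_add (hf.differentiable (by simp)) (hg.differentiable (by simp))]
    exact ih (contDiff_partialDeriv hf) (contDiff_partialDeriv hg)

theorem partialDeriv_const_smul (c : ℝ) (f : (Fin N → ℝ) → ℝ) :
    partialDeriv i (c • f) = c • partialDeriv i f :=
  funext fun _ => deriv_const_mul_field c

theorem iterate_partialDeriv_const_smul (c : ℝ) (f : (Fin N → ℝ) → ℝ) (k : ℕ) :
    (partialDeriv i)^[k] (c • f) = c • (partialDeriv i)^[k] f :=
  (Function.Commute.iterate_left (fun f => partialDeriv_const_smul c f) k) f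

theorem iterate_partialDeriv_mul_comp {a : (Fin N → ℝ) → ℝ}
    (ha : ∀ x t, a (Function.update x i t) = a x) (ρ : ℝ → ℝ) (m : ℕ) :
    (partialDeriv i)^[m] (fun x => a x * ρ (x i)) = fun x => a x * iteratedDeriv m ρ (x i) := by
  induction m with
  | zero => simp
  | succ m ih =>
    rw [Function.iterate_succ_apply', ih]
    ext x
    simp [partialDeriv, ha, iteratedDeriv_succ]

end PartialDeriv

/-- The smooth functions that vanish outside the closed box `[δ, 1 - δ]^N`, where `0 < δ ≤ 1 / 4`:
every `C_c^∞` function on the cube is of this form, and the upper bound on `δ` makes room for the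
support of `bumpProfile` in each coordinate. -/
structure SmoothInBox {E : Type*} [NormedAddCommGroup E] [NormedSpace ℝ E] (δ : ℝ)
    (f : (Fin N → ℝ) → E) : Prop where
  pos : 0 < δ
  le_quarter : δ ≤ 1 / 4
  contDiff : ContDiff ℝ ∞ f
  eq_zero : ∀ {x j}, x j ∉ Icc δ (1 - δ) → f x = 0

namespace SmoothInBox

variable {E : Type*} [NormedAddCommGroup E] [NormedSpace ℝ E] {δ : ℝ}

theorem add {f g : (Fin N → ℝ) → E} (hf : SmoothInBox δ f) (hg : SmoothInBox δ g) :
    SmoothInBox δ (f + g) :=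
  ⟨hf.pos, hf.le_quarter, hf.contDiff.add hg.contDiff,
    fun hj => by simp [hf.eq_zero hj, hg.eq_zero hj]⟩

theorem const_smul {f : (Fin N → ℝ) → E} (hf : SmoothInBox δ f) (c : ℝ) : SmoothInBox δ (c • f) :=
  ⟨hf.pos, hf.le_quarter, contDiff_const.smul hf.contDiff, fun hj => by simp [hf.eq_zero hj]⟩

theorem sub {f g : (Fin N → ℝ) → E} (hf : SmoothInBox δ f) (hg : SmoothInBox δ g) :
    SmoothInBox δ (f - g) := by
  simpa [sub_eq_add_neg] using hf.add (hg.const_smul (-1))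

theorem pi {ι : Type*} [Fintype ι] {φ : (Fin N → ℝ) → ι → ℝ} (hδ : 0 < δ) (hδ' : δ ≤ 1 / 4)
    (hφ : ∀ a, SmoothInBox δ fun x => φ x a) : SmoothInBox δ φ :=
  ⟨hδ, hδ', contDiff_pi.2 fun a => (hφ a).contDiff, fun hj => funext fun a => (hφ a).eq_zero hj⟩

theorem apply {ι : Type*} [Fintype ι] {φ : (Fin N → ℝ) → ι → ℝ} (hφ : SmoothInBox δ φ) (a : ι) :
    SmoothInBox δ fun x => φ x a :=
  ⟨hφ.pos, hφ.le_quarter, contDiff_pi.1 hφ.contDiff a, fun hj => congrFun (hφ.eq_zero hj) a⟩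

theorem tsupport_subset {f : (Fin N → ℝ) → E} (hf : SmoothInBox δ f) :
    tsupport f ⊆ Icc (fun _ => δ) (fun _ => 1 - δ) := by
  refine closure_minimal (fun x hx => ?_) isClosed_Icc
  have h (j : Fin N) : x j ∈ Icc δ (1 - δ) := not_not.1 fun hj => hx (hf.eq_zero hj)
  exact ⟨fun j => (h j).1, fun j => (h j).2⟩

theorem hasCompactSupport {f : (Fin N → ℝ) → E} (hf : SmoothInBox δ f) : HasCompactSupport f :=
  isCompact_Icc.of_isClosed_subset (isClosed_tsupport f) hf.tsupport_subset

theorem tsupport_subset_unitCube {f : (Fin N → ℝ) → E} (hf : SmoothInBox δ f) :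
    tsupport f ⊆ unitCube N := fun x hx j =>
  have h := hf.tsupport_subset hx
  ⟨hf.pos.trans_le (h.1 j), (h.2 j).trans_lt (by linarith [hf.pos])⟩

variable {f : (Fin N → ℝ) → ℝ}

theorem partialDeriv (hf : SmoothInBox δ f) (i : Fin N) : SmoothInBox δ (partialDeriv i f) where
  pos := hf.pos
  le_quarter := hf.le_quarter
  contDiff := contDiff_partialDeriv hf.contDiff
  eq_zero {x j} hj := by
    have hxf : x ∉ tsupport f := fun hx =>
      have h := hf.tsupport_subset hx
      hj ⟨h.1 j, h.2 j⟩
    rw [partialDeriv_eq_fderiv (hf.contDiff.differentiable (by simp) x),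
      fderiv_of_notMem_tsupport ℝ hxf, zero_apply]

theorem iterate_partialDeriv (hf : SmoothInBox δ f) (i : Fin N) (k : ℕ) :
    SmoothInBox δ ((FracTV.partialDeriv i)^[k] f) := by
  induction k with
  | zero => exact hf
  | succ k ih => rw [Function.iterate_succ_apply']; exact ih.partialDeriv i

end SmoothInBox

theorem exists_smoothInBox {E : Type*} [NormedAddCommGroup E] [NormedSpace ℝ E]
    {φ : (Fin N → ℝ) → E} (hφ : ContDiff ℝ ∞ φ) (hc : HasCompactSupport φ)
    (hsub : tsupport φ ⊆ unitCube N) : ∃ δ, SmoothInBox δ φ := by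
  have hev (j : Fin N) : ∀ᶠ δ in 𝓝[>] (0 : ℝ), ∀ x ∈ tsupport φ, x j ∈ Icc δ (1 - δ) := by
    obtain ⟨c, hc0, h⟩ := hc.isCompact.exists_forall_le' (f := fun x => min (x j) (1 - x j))
      (a := 0) (by fun_prop) (fun x hx => lt_min (hsub hx j).1 (by linarith [(hsub hx j).2]))
    filter_upwards [Ioc_mem_nhdsGT hc0] with δ hδ x hx
    obtain ⟨hleft, hright⟩ := le_min_iff.1 (hδ.2.trans (h x hx))
    exact ⟨hleft, by linarith⟩
  obtain ⟨δ, hδ, hδ0, hδ'⟩ := ((eventually_all.2 hev).and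
    (Ioc_mem_nhdsGT (show (0 : ℝ) < 1 / 4 by norm_num))).exists
  exact ⟨δ, hδ0, hδ', hφ, fun {x j} hj =>
    image_eq_zero_of_notMem_tsupport fun hx => hj (hδ j x hx)⟩

section Slices

namespace SmoothInBox

variable {δ : ℝ} {f : (Fin N → ℝ) → ℝ}

theorem slice_eq_zero (hf : SmoothInBox δ f) {i : Fin N} (x : Fin N → ℝ) {t : ℝ}
    (ht : t ∉ Icc δ (1 - δ)) : f (Function.update x i t) = 0 :=
  hf.eq_zero (j := i) (by rwa [Function.update_self])

theorem slice_eq_zero_of_ne (hf : SmoothInBox δ f) {i j : Fin N} (hji : j ≠ i) {x : Fin N → ℝ}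
    (hj : x j ∉ Icc δ (1 - δ)) (t : ℝ) : f (Function.update x i t) = 0 :=
  hf.eq_zero (j := j) (by rwa [Function.update_of_ne hji])

theorem contDiff_slice (hf : SmoothInBox δ f) (i : Fin N) (x : Fin N → ℝ) :
    ContDiff ℝ ∞ fun t => f (Function.update x i t) :=
  hf.contDiff.comp (contDiff_update ∞ x i)

theorem hasCompactSupport_slice (hf : SmoothInBox δ f) (i : Fin N) (x : Fin N → ℝ) :
    HasCompactSupport fun t => f (Function.update x i t) :=
  .intro isCompact_Icc fun _ ht => hf.slice_eq_zero x ht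

theorem deriv_slice (hf : SmoothInBox δ f) (i : Fin N) (x : Fin N → ℝ) :
    deriv (fun t => f (Function.update x i t)) =
      fun t => FracTV.partialDeriv i f (Function.update x i t) :=
  funext fun _ => (hasDerivAt_comp_update (hf.contDiff.differentiable (by simp) _)).deriv

theorem contDiff_convolution_slice (hf : SmoothInBox δ f) {κ : ℝ → ℝ} (hκ : LocallyIntegrable κ)
    (i : Fin N) :
    ContDiff ℝ ∞ fun q : (Fin N → ℝ) × ℝ => (κ ⋆ fun t => f (Function.update q.1 i t)) q.2 := by
  have hupdate : ContDiff ℝ ∞ fun q : (Fin N → ℝ) × ℝ => Function.update q.1 i q.2 := by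
    refine contDiff_pi.2 fun j => ?_
    obtain rfl | hji := eq_or_ne j i
    · simpa using contDiff_snd
    · simpa [hji] using contDiff_pi.1 contDiff_fst j
  rw [← contDiffOn_univ, ← univ_prod_univ]
  exact contDiffOn_convolution_right_with_param _ isOpen_univ (isCompact_Icc (a := δ) (b := 1 - δ))
    (fun x t _ ht => hf.slice_eq_zero x ht) hκ (hf.contDiff.comp hupdate).contDiffOn

end SmoothInBox

theorem convolution_indicator_Ici_eq_intervalIntegral {w : ℝ → ℝ} (hw : Continuous w)
    (hw0 : ∀ t ≤ 0, w t = 0) (y : ℝ) :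
    ((Ici 0).indicator 1 ⋆ w) y = ∫ t in (0 : ℝ)..y, w t := by
  have hκ (t : ℝ) : (Ici 0).indicator (1 : ℝ → ℝ) (y - t) • w t = (Iic y).indicator w t := by
    by_cases ht : t ≤ y <;> simp [ht]
  have hIic0 : ∀ t ∈ Iic (0 : ℝ), w t = 0 := hw0
  have hint (b : ℝ) : IntegrableOn w (Iic b) := by
    refine (hw.integrableOn_Icc (a := 0) (b := b)).of_forall_sdiff_eq_zero measurableSet_Iic
      fun t ht => hw0 t (not_lt.1 fun h => ht.2 ⟨h.le, ht.1⟩)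
  rw [convolution_lsmul_swap]
  simp only [hκ]
  rw [integral_indicator measurableSet_Iic,
    ← intervalIntegral.integral_Iic_sub_Iic (hint 0) (hint y),
    setIntegral_eq_zero_of_forall_eq_zero hIic0, sub_zero]

end Slices

section Antiderivative

/-- A fixed smooth bump of unit mass supported in `[1/4, 3/4]`. -/
noncomputable def bumpProfile : ℝ → ℝ :=
  (⟨1 / 8, 1 / 4, by norm_num, by norm_num⟩ : ContDiffBump (1 / 2 : ℝ)).normed volume

theorem contDiff_bumpProfile : ContDiff ℝ ∞ bumpProfile := ContDiffBump.contDiff_normed _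

theorem bumpProfile_eq_zero {t : ℝ} (ht : t ∉ Icc (1 / 4 : ℝ) (3 / 4)) : bumpProfile t = 0 := by
  refine Function.notMem_support.1 fun h => ht ?_
  rw [bumpProfile, ContDiffBump.support_normed_eq, Real.ball_eq_Ioo] at h
  convert! Ioo_subset_Icc_self h using 2 <;> norm_num

theorem integral_bumpProfile : ∫ t in (0 : ℝ)..1, bumpProfile t = 1 := by
  rw [intervalIntegral.integral_eq_integral_of_support_subset, bumpProfile,
    ContDiffBump.integral_normed]
  intro t ht
  have h : t ∈ Icc (1 / 4 : ℝ) (3 / 4) := not_not.1 fun h => ht (bumpProfile_eq_zero h)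
  constructor <;> linarith [h.1, h.2]

theorem exists_abs_iteratedDeriv_bumpProfile_le (m : ℕ) :
    ∃ B, ∀ t, |iteratedDeriv m bumpProfile t| ≤ B := by
  have hc : HasCompactSupport bumpProfile := .intro isCompact_Icc fun _ => bumpProfile_eq_zero
  obtain ⟨B, hB⟩ := (hc.iteratedFDeriv (𝕜 := ℝ) m).exists_bound_of_continuous
    (contDiff_bumpProfile.continuous_iteratedFDeriv (by exact_mod_cast le_top))
  exact ⟨B, fun t => by simpa [norm_iteratedFDeriv_eq_norm_iteratedDeriv] using hB t⟩

/-- The mean of `f` over the unit interval in the direction `i`, as a function of the point `x`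
which is constant in the `i`-th variable. -/
noncomputable def lineMean (i : Fin N) (f : (Fin N → ℝ) → ℝ) (x : Fin N → ℝ) : ℝ :=
  ∫ t in (0 : ℝ)..1, f (Function.update x i t)

/-- The line means of `f` in the direction `i` spread out along `bumpProfile`: subtracting it
from `f` leaves a function whose line means vanish. -/
noncomputable def meanPart (i : Fin N) (f : (Fin N → ℝ) → ℝ) (x : Fin N → ℝ) : ℝ :=
  lineMean i f x * bumpProfile (x i)

/-- The antiderivative of `f` in the `i`-th variable vanishing on the face `x i = 0`. -/
noncomputable def antideriv (i : Fin N) (f : (Fin N → ℝ) → ℝ) (x : Fin N → ℝ) : ℝ :=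
  ∫ t in (0 : ℝ)..x i, f (Function.update x i t)

variable {i : Fin N} {δ M : ℝ} {f : (Fin N → ℝ) → ℝ}

theorem lineMean_update (x : Fin N → ℝ) (t : ℝ) :
    lineMean i f (Function.update x i t) = lineMean i f x := by
  simp only [lineMean, Function.update_idem]

theorem abs_lineMean_le (hM : ∀ x, |f x| ≤ M) (x : Fin N → ℝ) : |lineMean i f x| ≤ M := by
  simpa [lineMean] using intervalIntegral.norm_integral_le_of_norm_le_const (a := (0 : ℝ)) (b := 1)
    (f := fun t => f (Function.update x i t)) fun t _ => hM _

theorem lineMean_sub_meanPart (hf : Continuous f) : lineMean i (f - meanPart i f) = 0 := by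
  ext x
  have hslice : Continuous fun t => f (Function.update x i t) :=
    hf.comp (continuous_const.update i continuous_id)
  have hbump : Continuous fun t => lineMean i f x * bumpProfile t :=
    contDiff_bumpProfile.continuous.const_mul _
  calc lineMean i (f - meanPart i f) x
      = ∫ t in (0 : ℝ)..1, (f (Function.update x i t) - lineMean i f x * bumpProfile t) := by
        simp only [lineMean, meanPart, Pi.sub_apply, Function.update_idem, Function.update_self]
    _ = lineMean i f x - lineMean i f x := by
        rw [intervalIntegral.integral_sub (hslice.intervalIntegrable _ _)
          (hbump.intervalIntegrable _ _), intervalIntegral.integral_const_mul,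
          integral_bumpProfile, mul_one, lineMean]
    _ = 0 := sub_self _

theorem partialDeriv_antideriv (hf : Continuous f) : partialDeriv i (antideriv i f) = f := by
  ext x
  have hslice : Continuous fun t => f (Function.update x i t) :=
    hf.comp (continuous_const.update i continuous_id)
  simpa only [partialDeriv, antideriv, Function.update_idem, Function.update_self,
    Function.update_eq_self] using (hslice.integral_hasStrictDerivAt 0 (x i)).hasDerivAt.deriv

namespace SmoothInBox

theorem contDiff_intervalIntegral_slice (hf : SmoothInBox δ f) (i : Fin N) :
    ContDiff ℝ ∞ fun q : (Fin N → ℝ) × ℝ => ∫ t in (0 : ℝ)..q.2, f (Function.update q.1 i t) := by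
  have hκ : LocallyIntegrable ((Ici 0).indicator (1 : ℝ → ℝ)) :=
    (locallyIntegrable_const 1).indicator measurableSet_Ici
  convert hf.contDiff_convolution_slice hκ i using 2 with q
  exact (convolution_indicator_Ici_eq_intervalIntegral (hf.contDiff_slice i q.1).continuous
    (fun t ht => hf.slice_eq_zero _ fun h => by linarith [hf.pos, h.1]) q.2).symm

theorem meanPart (hf : SmoothInBox δ f) (i : Fin N) : SmoothInBox δ (meanPart i f) where
  pos := hf.pos
  le_quarter := hf.le_quarter
  contDiff := (hf.contDiff_intervalIntegral_slice i |>.comp (contDiff_prodMk_left 1)).mul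
    (contDiff_bumpProfile.comp (contDiff_apply ℝ ℝ i))
  eq_zero {x j} hj := by
    obtain rfl | hji := eq_or_ne j i
    · have h : bumpProfile (x j) = 0 := bumpProfile_eq_zero fun h =>
        hj ⟨by linarith [h.1, hf.le_quarter], by linarith [h.2, hf.le_quarter]⟩
      rw [FracTV.meanPart, h, mul_zero]
    · simp [FracTV.meanPart, lineMean, hf.slice_eq_zero_of_ne hji hj]

theorem antideriv (hf : SmoothInBox δ f) (hmean : lineMean i f = 0) :
    SmoothInBox δ (antideriv i f) where
  pos := hf.pos
  le_quarter := hf.le_quarter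
  contDiff := hf.contDiff_intervalIntegral_slice i |>.comp
    (contDiff_id.prodMk (contDiff_apply ℝ ℝ i))
  eq_zero {x j} hj := by
    obtain rfl | hji := eq_or_ne j i
    · have hint (a b : ℝ) :
          IntervalIntegrable (fun t => f (Function.update x j t)) volume a b :=
        (hf.contDiff_slice j x).continuous.intervalIntegrable a b
      have hzero {a b : ℝ} (h : uIoc a b ⊆ (Icc δ (1 - δ))ᶜ) :
          ∫ t in a..b, f (Function.update x j t) = 0 :=
        intervalIntegral.integral_zero_ae <| .of_forall fun t ht => hf.slice_eq_zero x (h ht)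
      rcases not_and_or.1 hj with hleft | hright
      · refine hzero fun t ht h => ?_
        exact absurd (ht.2.trans_lt (max_lt hf.pos (not_le.1 hleft))) (not_lt.2 h.1)
      · have htail : ∫ t in 1..x j, f (Function.update x j t) = 0 := by
          refine hzero fun t ht h => absurd (lt_of_lt_of_le ?_ ht.1.le) (not_lt.2 h.2)
          exact lt_min (by linarith [hf.pos]) (not_le.1 hright)
        rw [FracTV.antideriv, ← intervalIntegral.integral_add_adjacent_intervals (hint 0 1)
          (hint 1 (x j)), htail, add_zero]
        exact congrFun hmean x
    · simp [FracTV.antideriv, hf.slice_eq_zero_of_ne hji hj]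

theorem abs_antideriv_le (hf : SmoothInBox δ f) (hmean : lineMean i f = 0)
    (hM : ∀ x, |f x| ≤ M) (x : Fin N → ℝ) : |FracTV.antideriv i f x| ≤ M := by
  have hM0 : 0 ≤ M := (abs_nonneg _).trans (hM 0)
  by_cases hx : x i ∈ Icc δ (1 - δ)
  · have hxi : |x i - 0| ≤ 1 := by rw [abs_le]; constructor <;> linarith [hx.1, hx.2, hf.pos]
    exact (intervalIntegral.norm_integral_le_of_norm_le_const
      (f := fun t => f (Function.update x i t)) fun t _ => hM _).trans
      (mul_le_of_le_one_right hM0 hxi)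
  · rw [(hf.antideriv hmean).eq_zero hx, abs_zero]
    exact hM0

end SmoothInBox

theorem exists_abs_iterate_partialDeriv_meanPart_le (m : ℕ) :
    ∃ B : ℝ, 0 ≤ B ∧ ∀ (i : Fin N) {f : (Fin N → ℝ) → ℝ} {M : ℝ}, (∀ x, |f x| ≤ M) →
      ∀ x, |(partialDeriv i)^[m] (meanPart i f) x| ≤ B * M := by
  obtain ⟨B, hB⟩ := exists_abs_iteratedDeriv_bumpProfile_le m
  refine ⟨B, (abs_nonneg _).trans (hB 0), fun i f M hM x => ?_⟩
  have h : (partialDeriv i)^[m] (meanPart i f) =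
      fun x => lineMean i f x * iteratedDeriv m bumpProfile (x i) :=
    iterate_partialDeriv_mul_comp lineMean_update bumpProfile m
  rw [h, abs_mul, mul_comm B]
  exact mul_le_mul (abs_lineMean_le hM x) (hB _) (abs_nonneg _) ((abs_nonneg _).trans (hM 0))

theorem SmoothInBox.exists_eq_iterate_partialDeriv_add (k : ℕ) :
    ∃ R : ℝ, 0 ≤ R ∧ ∀ {δ : ℝ} {ψ : (Fin N → ℝ) → ℝ}, SmoothInBox δ ψ →
      ∀ {M : ℝ}, (∀ x, |ψ x| ≤ M) → ∀ i,
        ∃ φ η, SmoothInBox δ φ ∧ SmoothInBox δ η ∧ ψ = (FracTV.partialDeriv i)^[k] φ + η ∧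
          (∀ x, |φ x| ≤ R * M) ∧ ∀ x, |FracTV.partialDeriv i η x| ≤ R * M := by
  induction k with
  | zero =>
    refine ⟨1, zero_le_one, fun {δ ψ} hψ M hM i =>
      ⟨ψ, (0 : ℝ) • ψ, hψ, hψ.const_smul 0, by simp, by simpa using hM, fun x => ?_⟩⟩
    rw [partialDeriv_const_smul]
    simpa using (abs_nonneg _).trans (hM 0)
  | succ k ih =>
    obtain ⟨R, hR, ih⟩ := ih
    obtain ⟨B₀, hB₀, hmean₀⟩ := exists_abs_iterate_partialDeriv_meanPart_le (N := N) 0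
    obtain ⟨B, hB, hmean⟩ := exists_abs_iterate_partialDeriv_meanPart_le (N := N) (k + 1)
    refine ⟨(1 + B₀ + B) * R, by positivity, fun {δ ψ} hψ M hM i => ?_⟩
    obtain ⟨φ, η, hφ, hη, hψ_eq, hφM, hηM⟩ := ih hψ hM i
    have hRM : 0 ≤ R * M := (abs_nonneg _).trans (hφM 0)
    have hg := hφ.sub (hφ.meanPart i)
    have hg_mean := lineMean_sub_meanPart (i := i) hφ.contDiff.continuous
    have hgM (x) : |(φ - FracTV.meanPart i φ) x| ≤ R * M + B₀ * (R * M) :=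
      (abs_sub _ _).trans (add_le_add (hφM x) (hmean₀ i hφM x))
    have hη' := (hφ.meanPart i).iterate_partialDeriv i k
    refine ⟨FracTV.antideriv i (φ - FracTV.meanPart i φ),
      (FracTV.partialDeriv i)^[k] (FracTV.meanPart i φ) + η, hg.antideriv hg_mean, hη'.add hη,
      ?_, fun x => ?_, fun x => ?_⟩
    · rw [Function.iterate_succ_apply, partialDeriv_antideriv hg.contDiff.continuous, ← add_assoc,
        ← iterate_partialDeriv_add hg.contDiff (hφ.meanPart i).contDiff, sub_add_cancel]
      exact hψ_eq
    · have h := hg.abs_antideriv_le hg_mean hgM x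
      linarith [mul_nonneg hB hRM]
    · rw [partialDeriv_add (hη'.contDiff.differentiable (by simp))
        (hη.contDiff.differentiable (by simp)),
        ← Function.iterate_succ_apply' (FracTV.partialDeriv i)]
      have h := (abs_add_le _ _).trans (add_le_add (hmean i hφM x) (hηM x))
      exact h.trans (by linarith [mul_nonneg hB₀ hRM])

end Antiderivative

section RiemannLiouville

/-- The convolution kernel of the right-sided fractional integral: up to the factor `Γ(1 - s)`, the
integral of order `1 - s` of a function vanishing on `(1, ∞)` is its convolution with `rlKernel s`,
because `(-r)^(-s)` at `r = x - t` is `(t - x)^(-s)`. -/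
noncomputable def rlKernel (s : ℝ) : ℝ → ℝ := (Iio 0).indicator fun r => (-r) ^ (-s)

variable {s A : ℝ} {w : ℝ → ℝ}

theorem locallyIntegrable_rlKernel (hs : s < 1) : LocallyIntegrable (rlKernel s) := by
  have hmeas : Measurable (rlKernel s) := by unfold rlKernel; fun_prop (disch := measurability)
  refine locallyIntegrable_of_norm_le_rpow (C := 1) (α := s) (by simp) (by simpa using hs)
    (.of_forall fun r => ?_) hmeas.aestronglyMeasurable
  obtain hr | hr := lt_or_ge r 0
  · simp [rlKernel, hr, abs_of_neg hr, Real.abs_rpow_of_nonneg (neg_nonneg.2 hr.le)]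
  · simpa [rlKernel, hr.not_gt] using Real.rpow_nonneg (abs_nonneg r) (-s)

theorem rlKernel_convolution (hw : ∀ t, 1 < t → w t = 0) (y : ℝ) :
    (rlKernel s ⋆ w) y = ∫ t in y..1, w t / (t - y) ^ s := by
  have hIoi : (fun t => rlKernel s (y - t) • w t) =
      (Ioi y).indicator fun t => w t / (t - y) ^ s := by
    ext t
    by_cases ht : y < t
    · simp [rlKernel, ht, Real.rpow_neg (sub_nonneg.2 ht.le), div_eq_inv_mul]
    · simp [rlKernel, ht]
  rw [convolution_lsmul_swap, hIoi, integral_indicator measurableSet_Ioi]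
  obtain hy | hy := le_total y 1
  · rw [intervalIntegral.integral_of_le hy]
    refine setIntegral_eq_of_subset_of_forall_sdiff_eq_zero measurableSet_Ioi Ioc_subset_Ioi_self
      fun t ht => ?_
    rw [hw t (not_le.1 fun h => ht.2 ⟨ht.1, h⟩), zero_div]
  · rw [setIntegral_eq_zero_of_forall_eq_zero fun t ht => by
      rw [hw t (hy.trans_lt ht), zero_div], intervalIntegral.integral_symm,
      intervalIntegral.integral_zero_ae, neg_zero]
    refine .of_forall fun t ht => ?_
    rw [uIoc_of_le hy] at ht
    rw [hw t ht.1, zero_div]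

theorem rlDerivRight_eq_convolution (hs : s < 1) (hw : ContDiff ℝ 1 w) (hwc : HasCompactSupport w)
    (hw1 : ∀ t, 1 < t → w t = 0) (x : ℝ) :
    rlDerivRight s w x = -(1 / Real.Gamma (1 - s)) * (rlKernel s ⋆ deriv w) x := by
  simp only [rlDerivRight, ← rlKernel_convolution hw1]
  rw [(hwc.hasDerivAt_convolution_right (.lsmul ℝ ℝ) (locallyIntegrable_rlKernel hs) hw x).deriv]

theorem rlDerivRight_const_mul (c : ℝ) (w : ℝ → ℝ) (x : ℝ) :
    rlDerivRight s (fun t => c * w t) x = c * rlDerivRight s w x := by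
  simp only [rlDerivRight, mul_div_assoc, intervalIntegral.integral_const_mul,
    deriv_const_mul_field]
  ring

theorem rlDerivRight_add {v : ℝ → ℝ} (hs : s < 1) (hv : ContDiff ℝ 1 v)
    (hvc : HasCompactSupport v) (hv1 : ∀ t, 1 < t → v t = 0) (hw : ContDiff ℝ 1 w)
    (hwc : HasCompactSupport w) (hw1 : ∀ t, 1 < t → w t = 0) (x : ℝ) :
    rlDerivRight s (v + w) x = rlDerivRight s v x + rlDerivRight s w x := by
  have hκ := locallyIntegrable_rlKernel hs
  have hconv {f : ℝ → ℝ} (hf : ContDiff ℝ 1 f) (hfc : HasCompactSupport f) :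
      ConvolutionExists (rlKernel s) (deriv f) (.lsmul ℝ ℝ) volume :=
    hfc.deriv.convolutionExists_right _ hκ (hf.continuous_deriv le_rfl)
  have hderiv : deriv (v + w) = deriv v + deriv w := funext fun t =>
    deriv_add (hv.differentiable (by simp) t) (hw.differentiable (by simp) t)
  rw [rlDerivRight_eq_convolution (w := v + w) hs (hv.add hw) (hvc.add hwc)
      (fun t ht => by simp [hv1 t ht, hw1 t ht]), hderiv,
    (hconv hv hvc).distrib_add (hconv hw hwc), Pi.add_apply, mul_add,
    ← rlDerivRight_eq_convolution hs hv hvc hv1, ← rlDerivRight_eq_convolution hs hw hwc hw1]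

theorem intervalIntegral_rpow_sub (hs : s < 1) (x y : ℝ) :
    ∫ t in x..y, (t - x) ^ (-s) = (y - x) ^ (1 - s) / (1 - s) := by
  rw [intervalIntegral.integral_comp_sub_right (fun t => t ^ (-s)), sub_self,
    integral_rpow (.inl (by linarith)), Real.zero_rpow (by linarith), sub_zero, neg_add_eq_sub]

theorem abs_rlKernel_convolution_le (hs : s < 1) (hw1 : ∀ t, 1 < t → w t = 0)
    (hA : ∀ t, |w t| ≤ A) {x : ℝ} (hx : x ∈ Icc 0 1) : |(rlKernel s ⋆ w) x| ≤ A / (1 - s) := by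
  have hA0 : 0 ≤ A := (abs_nonneg _).trans (hA 0)
  have hs' : 0 < 1 - s := sub_pos.2 hs
  have hpow : IntervalIntegrable (fun t => A * (t - x) ^ (-s)) volume x 1 := by
    have h := (intervalIntegral.intervalIntegrable_rpow' (a := 0) (b := 1 - x)
      (by linarith : -1 < -s)).comp_sub_right x
    simpa using h.const_mul A
  have hle (t : ℝ) (ht : t ∈ Ioc x 1) : ‖w t / (t - x) ^ s‖ ≤ A * (t - x) ^ (-s) := by
    have h : 0 ≤ t - x := sub_nonneg.2 ht.1.le
    have hpow0 : 0 ≤ (t - x) ^ s := Real.rpow_nonneg h s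
    rw [Real.rpow_neg h, ← div_eq_mul_inv, norm_div, Real.norm_of_nonneg hpow0]
    exact div_le_div_of_nonneg_right (hA t) hpow0
  calc |(rlKernel s ⋆ w) x| = |∫ t in x..1, w t / (t - x) ^ s| := by
        rw [rlKernel_convolution hw1]
    _ ≤ ∫ t in x..1, A * (t - x) ^ (-s) :=
        intervalIntegral.norm_integral_le_of_norm_le hx.2 (.of_forall hle) hpow
    _ = A * ((1 - x) ^ (1 - s) / (1 - s)) := by
        rw [intervalIntegral.integral_const_mul, intervalIntegral_rpow_sub hs]
    _ ≤ A * (1 / (1 - s)) := by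
        have h : (1 - x) ^ (1 - s) ≤ 1 :=
          Real.rpow_le_one (sub_nonneg.2 hx.2) (sub_le_self 1 hx.1) hs'.le
        gcongr
    _ = A / (1 - s) := mul_one_div _ _

theorem abs_rlDerivRight_le (hs : s < 1) (hw : ContDiff ℝ 1 w) (hwc : HasCompactSupport w)
    (hw1 : ∀ t, 1 < t → w t = 0) (hA : ∀ t, |deriv w t| ≤ A) {x : ℝ} (hx : x ∈ Icc 0 1) :
    |rlDerivRight s w x| ≤ A / Real.Gamma (2 - s) := by
  have hΓ : 0 < Real.Gamma (1 - s) := Real.Gamma_pos_of_pos (sub_pos.2 hs)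
  have hderiv1 (t : ℝ) (ht : 1 < t) : deriv w t = 0 := by
    have h : w =ᶠ[𝓝 t] 0 := by filter_upwards [Ioi_mem_nhds ht] with r hr using hw1 r hr
    simpa using h.deriv_eq
  calc |rlDerivRight s w x| = |(rlKernel s ⋆ deriv w) x| / Real.Gamma (1 - s) := by
        rw [rlDerivRight_eq_convolution hs hw hwc hw1, abs_mul, abs_neg,
          abs_of_pos (one_div_pos.2 hΓ), one_div_mul_eq_div]
    _ ≤ A / (1 - s) / Real.Gamma (1 - s) := by
        gcongr
        exact abs_rlKernel_convolution_le hs hderiv1 hA hx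
    _ = A / Real.Gamma (2 - s) := by
        rw [div_div, ← Real.Gamma_add_one (sub_pos.2 hs).ne']
        ring_nf

end RiemannLiouville

section FractionalDivergence

variable {s δ A : ℝ} {i : Fin N} {f g : (Fin N → ℝ) → ℝ}

theorem fracPartialDerivRight_const_smul (c : ℝ) (f : (Fin N → ℝ) → ℝ) (x : Fin N → ℝ) :
    fracPartialDerivRight s i (c • f) x = c * fracPartialDerivRight s i f x :=
  rlDerivRight_const_mul c _ _

namespace SmoothInBox

theorem slice_eq_zero_of_one_lt (hf : SmoothInBox δ f) (x : Fin N → ℝ) (t : ℝ) (ht : 1 < t) :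
    f (Function.update x i t) = 0 :=
  hf.slice_eq_zero x fun h => by linarith [hf.pos, h.2]

theorem fracPartialDerivRight_eq (hf : SmoothInBox δ f) (hs : s < 1) (i : Fin N) (x : Fin N → ℝ) :
    fracPartialDerivRight s i f x = -(1 / Real.Gamma (1 - s)) *
      (rlKernel s ⋆ fun t => FracTV.partialDeriv i f (Function.update x i t)) (x i) := by
  rw [← hf.deriv_slice]
  exact rlDerivRight_eq_convolution hs ((hf.contDiff_slice i x).of_le (by simp))
    (hf.hasCompactSupport_slice i x) (hf.slice_eq_zero_of_one_lt x) (x i)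

theorem continuous_fracPartialDerivRight (hf : SmoothInBox δ f) (hs : s < 1) (i : Fin N) :
    Continuous (fracPartialDerivRight s i f) := by
  rw [funext (hf.fracPartialDerivRight_eq hs i)]
  exact continuous_const.mul (((hf.partialDeriv i).contDiff_convolution_slice
    (locallyIntegrable_rlKernel hs) i).continuous.comp (continuous_id.prodMk (continuous_apply i)))

theorem fracPartialDerivRight_add (hf : SmoothInBox δ f) (hg : SmoothInBox δ g) (hs : s < 1)
    (i : Fin N) (x : Fin N → ℝ) : fracPartialDerivRight s i (f + g) x =
      fracPartialDerivRight s i f x + fracPartialDerivRight s i g x :=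
  rlDerivRight_add hs ((hf.contDiff_slice i x).of_le (by simp)) (hf.hasCompactSupport_slice i x)
    (hf.slice_eq_zero_of_one_lt x) ((hg.contDiff_slice i x).of_le (by simp))
    (hg.hasCompactSupport_slice i x) (hg.slice_eq_zero_of_one_lt x) (x i)

theorem abs_fracPartialDerivRight_le (hf : SmoothInBox δ f) (hs : s < 1)
    (hA : ∀ x, |FracTV.partialDeriv i f x| ≤ A) {x : Fin N → ℝ} (hx : x i ∈ Icc 0 1) :
    |fracPartialDerivRight s i f x| ≤ A / Real.Gamma (2 - s) :=
  abs_rlDerivRight_le hs ((hf.contDiff_slice i x).of_le (by simp)) (hf.hasCompactSupport_slice i x)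
    (hf.slice_eq_zero_of_one_lt x) (fun t => by rw [hf.deriv_slice]; exact hA _) hx

end SmoothInBox

theorem inv_le_Gamma {a : ℝ} (ha : 1 ≤ a) : a⁻¹ ≤ Real.Gamma a := by
  have h2 : (2 : ℝ) ∈ Ici 2 := self_mem_Ici
  have h := Real.Gamma_strictMonoOn_Ici.monotoneOn h2
    (show a + 1 ∈ Ici 2 by rw [mem_Ici]; linarith) (by linarith)
  rw [Real.Gamma_two, Real.Gamma_add_one (by positivity)] at h
  exact (inv_le_iff_one_le_mul₀' (by positivity)).2 h

theorem fracDiv_coeff_mem_Icc (N : ℕ) (hs0 : 0 ≤ s) (hs : s ≤ 1) :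
    (1 - 1 / (N : ℝ)) * s + 1 / (N : ℝ) ∈ Icc (0 : ℝ) 1 := by
  have hN0 : (0 : ℝ) ≤ 1 / N := by positivity
  have hN1 : 1 / (N : ℝ) ≤ 1 := by simpa using Nat.cast_inv_le_one N
  constructor <;> nlinarith

variable {F G : (Fin N → ℝ) → Fin N → ℝ}

theorem fracDiv_const_smul (c : ℝ) (F : (Fin N → ℝ) → Fin N → ℝ) (x : Fin N → ℝ) :
    fracDiv s (c • F) x = c * fracDiv s F x := by
  have h (i : Fin N) : fracPartialDerivRight s i (fun y => (c • F) y i) x =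
      c * fracPartialDerivRight s i (fun y => F y i) x :=
    fracPartialDerivRight_const_smul c _ x
  simp only [fracDiv, h, ← Finset.mul_sum, mul_left_comm]

theorem SmoothInBox.fracDiv_add (hF : SmoothInBox δ F) (hG : SmoothInBox δ G) (hs : s < 1)
    (x : Fin N → ℝ) : fracDiv s (F + G) x = fracDiv s F x + fracDiv s G x := by
  have h (i : Fin N) : fracPartialDerivRight s i (fun y => (F + G) y i) x =
      fracPartialDerivRight s i (fun y => F y i) x + fracPartialDerivRight s i (fun y => G y i) x :=
    (hF.apply i).fracPartialDerivRight_add (hG.apply i) hs i x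
  simp only [fracDiv, h, Finset.sum_add_distrib, mul_add]

theorem SmoothInBox.continuous_fracDiv (hF : SmoothInBox δ F) (hs : s < 1) :
    Continuous (fracDiv s F) :=
  continuous_const.mul <|
    continuous_finsetSum _ fun i _ => (hF.apply i).continuous_fracPartialDerivRight hs i

theorem SmoothInBox.abs_fracDiv_le (hF : SmoothInBox δ F) (hs0 : 0 ≤ s) (hs : s < 1)
    (hA : ∀ i x, |FracTV.partialDeriv i (fun y => F y i) x| ≤ A) {x : Fin N → ℝ}
    (hx : x ∈ unitCube N) : |fracDiv s F x| ≤ N * (2 * A) := by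
  obtain ⟨hκ0, hκ1⟩ := fracDiv_coeff_mem_Icc N hs0 hs.le
  have hΓ (i : Fin N) : A / Real.Gamma (2 - s) ≤ 2 * A := by
    have hA0 : 0 ≤ A := (abs_nonneg _).trans (hA i 0)
    have h : (2 : ℝ)⁻¹ ≤ Real.Gamma (2 - s) :=
      (inv_anti₀ (by linarith) (by linarith)).trans (inv_le_Gamma (by linarith))
    calc A / Real.Gamma (2 - s) ≤ A / 2⁻¹ := by gcongr
      _ = 2 * A := by ring
  calc |fracDiv s F x|
      ≤ |∑ i, fracPartialDerivRight s i (fun y => F y i) x| := by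
        rw [fracDiv, abs_mul, abs_of_nonneg hκ0]
        exact mul_le_of_le_one_left (abs_nonneg _) hκ1
    _ ≤ ∑ i, |fracPartialDerivRight s i (fun y => F y i) x| := Finset.abs_sum_le_sum_abs _ _
    _ ≤ ∑ _i : Fin N, 2 * A := Finset.sum_le_sum fun i _ =>
        ((hF.apply i).abs_fracPartialDerivRight_le hs (hA i)
          (Ioo_subset_Icc_self (hx i))).trans (hΓ i)
    _ = N * (2 * A) := by simp

theorem measurableSet_unitCube (N : ℕ) : MeasurableSet (unitCube N) := by
  have h : unitCube N = Set.pi univ fun _ => Ioo (0 : ℝ) 1 := by ext; simp [unitCube]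
  rw [h]
  exact .univ_pi fun _ => measurableSet_Ioo

theorem integrableOn_unitCube_mul {u g : (Fin N → ℝ) → ℝ} (hu : IntegrableOn u (unitCube N))
    (hg : Continuous g) : IntegrableOn (fun x => u x * g x) (unitCube N) :=
  hu.mul_continuousOn_of_subset hg.continuousOn (measurableSet_unitCube N) isCompact_Icc
    fun _ hx => ⟨fun i => (hx i).1.le, fun i => (hx i).2.le⟩

end FractionalDivergence

section DualNorm

variable {ι : Type} [Fintype ι] (p : ℝ≥0∞) [Fact (1 ≤ p)] (y : ι → ℝ)

theorem sum_mul_le_sum_abs {x : PiLp p fun _ : ι => ℝ} (hx : x ∈ Metric.closedBall 0 1) :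
    ∑ i, x i * y i ≤ ∑ i, |y i| := by
  refine Finset.sum_le_sum fun i _ => (le_abs_self _).trans ?_
  have h : |x i| ≤ 1 := (PiLp.norm_apply_le x i).trans (by simpa using hx)
  rw [abs_mul]
  exact mul_le_of_le_one_left (abs_nonneg _) h

theorem dualNorm_le_sum_abs : dualNorm p y ≤ ∑ i, |y i| := by
  refine csSup_le (.image _ ⟨0, by simp⟩) ?_
  rintro _ ⟨x, hx, rfl⟩
  exact sum_mul_le_sum_abs p y hx

theorem abs_apply_le_dualNorm (i : ι) : |y i| ≤ dualNorm p y := by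
  classical
  have hbdd : BddAbove ((fun x : PiLp p fun _ : ι => ℝ => ∑ i, x i * y i) ''
      Metric.closedBall 0 1) := by
    refine ⟨∑ i, |y i|, ?_⟩
    rintro _ ⟨x, hx, rfl⟩
    exact sum_mul_le_sum_abs p y hx
  have hsingle (c : ℝ) (hc : |c| ≤ 1) : c * y i ≤ dualNorm p y :=
    le_csSup hbdd ⟨PiLp.single p i c, by simpa [PiLp.norm_single] using hc, by simp⟩
  exact abs_le'.2 ⟨by simpa using hsingle 1 (by simp), by simpa using hsingle (-1) (by simp)⟩

end DualNorm

section TestFields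

/-- The tensor field of order `k + 1` carrying `φ i` in its diagonal entries `(i, (i, …, i))` and
zero elsewhere, so that its iterated divergence is the vector field `(∂_i^k φ_i)_i`. -/
noncomputable def diagonalField (k : ℕ) (φ : Fin N → (Fin N → ℝ) → ℝ) (x : Fin N → ℝ)
    (a : TensorIndex N k) : ℝ :=
  if a.2 = fun _ => a.1 then φ a.1 x else 0

variable {k : ℕ} {φ : Fin N → (Fin N → ℝ) → ℝ} {δ : ℝ}

theorem divIter_diagonalField (k : ℕ) (φ : Fin N → (Fin N → ℝ) → ℝ) :
    divIter k (diagonalField k φ) = fun x i => (partialDeriv i)^[k] (φ i) x := by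
  induction k generalizing φ with
  | zero => ext x i; simp [divIter, diagonalField, funext_iff]
  | succ k ih =>
    simp only [Function.iterate_succ_apply]
    rw [← ih fun i => partialDeriv i (φ i), divIter]
    congr 1
    ext x a
    have hsnoc (l : Fin N) : ((Fin.snoc a.2 l : Fin (k + 1) → Fin N) = fun _ => a.1) ↔
        l = a.1 ∧ a.2 = fun _ => a.1 := by
      simp only [funext_iff, Fin.forall_fin_succ', Fin.snoc_castSucc, Fin.snoc_last]
      tauto
    simp only [diagonalField, hsnoc]
    by_cases ha : a.2 = fun _ => a.1
    · rw [Finset.sum_eq_single a.1]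
      · simp [ha]
      · intro l _ hl
        simp [hl, partialDeriv]
      · simp
    · simp [ha, partialDeriv]

theorem sum_abs_diagonalField (k : ℕ) (φ : Fin N → (Fin N → ℝ) → ℝ) (x : Fin N → ℝ) :
    ∑ a, |diagonalField k φ x a| = ∑ i, |φ i x| := by
  simp [diagonalField, Fintype.sum_prod_type, apply_ite abs]

theorem SmoothInBox.diagonalField (hδ : 0 < δ) (hδ' : δ ≤ 1 / 4) (hφ : ∀ i, SmoothInBox δ (φ i)) :
    SmoothInBox δ (diagonalField k φ) := by
  refine .pi hδ hδ' fun a => ?_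
  by_cases ha : a.2 = fun _ => a.1
  · simpa [FracTV.diagonalField, ha] using hφ a.1
  · simpa [FracTV.diagonalField, ha] using! (hφ a.1).const_smul 0

theorem isTestField_diagonalField (p : ℝ≥0∞) [Fact (1 ≤ p)] (hδ : 0 < δ) (hδ' : δ ≤ 1 / 4)
    (hφ : ∀ i, SmoothInBox δ (φ i)) (hle : ∀ x, ∑ i, |φ i x| ≤ 1) :
    IsTestField p k (diagonalField k φ) :=
  have h : SmoothInBox δ (diagonalField k φ) := .diagonalField hδ hδ' hφ
  ⟨h.contDiff, h.hasCompactSupport, h.tsupport_subset_unitCube, fun x =>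
    (dualNorm_le_sum_abs p _).trans ((sum_abs_diagonalField k φ x).trans_le (hle x))⟩

theorem exists_divIter_add (N k : ℕ) : ∃ R : ℝ, 0 < R ∧
    ∀ (p : ℝ≥0∞) [Fact (1 ≤ p)] (ψ : (Fin N → ℝ) → TensorIndex N 0 → ℝ), IsTestField p 0 ψ →
      ∃ (δ : ℝ) (Φ : (Fin N → ℝ) → TensorIndex N k → ℝ) (η : (Fin N → ℝ) → Fin N → ℝ),
        IsTestField p k Φ ∧ SmoothInBox δ (divIter k Φ) ∧ SmoothInBox δ η ∧
        divIter 0 ψ = R • divIter k Φ + η ∧ ∀ i x, |partialDeriv i (fun y => η y i) x| ≤ R := by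
  obtain ⟨r, hr, hdec⟩ := SmoothInBox.exists_eq_iterate_partialDeriv_add (N := N) k
  obtain ⟨R, hR, hrR, hNrR⟩ : ∃ R, 0 < R ∧ r ≤ R ∧ N * r ≤ R :=
    ⟨(N + 1) * r + 1, by positivity, by nlinarith [Nat.cast_nonneg (α := ℝ) N], by linarith⟩
  refine ⟨R, hR, fun p _ ψ ⟨hψ, hψ_compact, hψ_supp, hψ_norm⟩ => ?_⟩
  obtain ⟨δ, hψδ⟩ := exists_smoothInBox hψ hψ_compact hψ_supp
  choose φ η hφ hη hψ_eq hφr hηr using fun i : Fin N =>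
    hdec (M := 1) (hψδ.apply (i, Fin.elim0))
      (fun x => (abs_apply_le_dualNorm p (ψ x) _).trans (hψ_norm x)) i
  have hdiv : divIter k (diagonalField k fun i => R⁻¹ • φ i) =
      R⁻¹ • fun x i => (partialDeriv i)^[k] (φ i) x := by
    simp only [divIter_diagonalField, iterate_partialDeriv_const_smul]
    rfl
  have hφ_sum (x : Fin N → ℝ) : ∑ i, |(R⁻¹ • φ i) x| ≤ 1 := calc
    ∑ i, |(R⁻¹ • φ i) x| = R⁻¹ * ∑ i, |φ i x| := by simp [abs_mul, abs_of_pos hR, Finset.mul_sum]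
    _ ≤ R⁻¹ * ∑ _i : Fin N, r := by
      gcongr with i
      simpa using hφr i x
    _ ≤ 1 := by simpa [inv_mul_le_iff₀ hR] using hNrR
  refine ⟨δ, diagonalField k fun i => R⁻¹ • φ i, fun x i => η i x,
    isTestField_diagonalField p hψδ.pos hψδ.le_quarter (fun i => (hφ i).const_smul _) hφ_sum, ?_,
    .pi hψδ.pos hψδ.le_quarter hη, ?_, fun i x => (hηr i x).trans (by rwa [mul_one])⟩
  · rw [hdiv]
    exact (SmoothInBox.pi hψδ.pos hψδ.le_quarter fun i =>
      (hφ i).iterate_partialDeriv i k).const_smul _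
  · rw [hdiv, smul_inv_smul₀ hR.ne']
    ext x i
    exact congrFun (hψ_eq i) x

end TestFields

theorem ofReal_integral_mul_le {α : Type*} [MeasurableSpace α] {μ : Measure α} {u g : α → ℝ}
    {B : ℝ} (hg : ∀ᵐ x ∂μ, |g x| ≤ B) :
    ENNReal.ofReal (∫ x, u x * g x ∂μ) ≤ ENNReal.ofReal B * eLpNorm u 1 μ := calc
  ENNReal.ofReal (∫ x, u x * g x ∂μ) ≤ ∫⁻ x, ‖u x * g x‖ₑ ∂μ :=
    (Real.ofReal_le_enorm _).trans (enorm_integral_le_lintegral_enorm _)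
  _ ≤ ∫⁻ x, ENNReal.ofReal B * ‖u x‖ₑ ∂μ := by
    refine lintegral_mono_ae (hg.mono fun x hx => ?_)
    rw [enorm_mul, mul_comm, ← ofReal_norm (g x)]
    gcongr
    exact hx
  _ = ENNReal.ofReal B * eLpNorm u 1 μ := by
    rw [lintegral_const_mul' _ _ ENNReal.ofReal_ne_top, eLpNorm_one_eq_lintegral_enorm]

theorem ofReal_integral_fracDiv_divIter_le_TV {p : ℝ≥0∞} [Fact (1 ≤ p)] {k : ℕ}
    {φ : (Fin N → ℝ) → TensorIndex N k → ℝ} (hφ : IsTestField p k φ) (s : ℝ)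
    (u : (Fin N → ℝ) → ℝ) :
    ENNReal.ofReal (∫ x in unitCube N, u x * fracDiv s (divIter k φ) x) ≤ TV p k s u :=
  le_iSup₂_of_le φ hφ le_rfl

theorem SmoothInBox.integral_mul_fracDiv_smul_add {δ s : ℝ} {u : (Fin N → ℝ) → ℝ}
    {F G : (Fin N → ℝ) → Fin N → ℝ} (hF : SmoothInBox δ F) (hG : SmoothInBox δ G) (hs : s < 1)
    (hu : IntegrableOn u (unitCube N)) (c : ℝ) :
    ∫ x in unitCube N, u x * fracDiv s (c • F + G) x =
      c * (∫ x in unitCube N, u x * fracDiv s F x) + ∫ x in unitCube N, u x * fracDiv s G x := by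
  have hFint := integrableOn_unitCube_mul hu (hF.continuous_fracDiv hs)
  have hGint := integrableOn_unitCube_mul hu (hG.continuous_fracDiv hs)
  simp only [(hF.const_smul c).fracDiv_add hG hs, fracDiv_const_smul, mul_add, mul_left_comm _ c]
  rw [integral_add (hFint.const_mul c) hGint, integral_const_mul]

end FracTV

theorem proposition4p9_general (N k : ℕ) :
    ∃ C : ℝ, 0 < C ∧ ∀ (p : ℝ≥0∞) [Fact (1 ≤ p)] (s : ℝ), 0 ≤ s → s < 1 →
      ∀ u : (Fin N → ℝ) → ℝ, IntegrableOn u (FracTV.unitCube N) →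
        FracTV.TV p 0 s u ≤
          ENNReal.ofReal C *
            (eLpNorm u 1 (volume.restrict (FracTV.unitCube N)) + FracTV.TV p k s u) := by
  obtain ⟨R, hR, hdec⟩ := FracTV.exists_divIter_add N k
  refine ⟨N * (2 * R) + R, by positivity, fun p _ s hs0 hs u hu => iSup₂_le fun ψ hψ => ?_⟩
  obtain ⟨δ, Φ, η, hΦ, hdivΦ, hη, hψ_eq, hηR⟩ := hdec p ψ hψ
  have hη_le : ENNReal.ofReal (∫ x in FracTV.unitCube N, u x * FracTV.fracDiv s η x) ≤
      ENNReal.ofReal (N * (2 * R)) * eLpNorm u 1 (volume.restrict (FracTV.unitCube N)) :=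
    FracTV.ofReal_integral_mul_le <| (ae_restrict_mem (FracTV.measurableSet_unitCube N)).mono
      fun x hx => hη.abs_fracDiv_le hs0 hs hηR hx
  rw [hψ_eq, hdivΦ.integral_mul_fracDiv_smul_add hη hs hu, add_comm (eLpNorm _ _ _), mul_add]
  refine ENNReal.ofReal_add_le.trans (add_le_add ?_ (hη_le.trans ?_))
  · rw [ENNReal.ofReal_mul hR.le]
    gcongr
    · exact le_add_of_nonneg_left (by positivity)
    · exact FracTV.ofReal_integral_fracDiv_divIter_le_TV hΦ s u
  · gcongr
    exact le_add_of_nonneg_right hR.le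

theorem proposition4p9 (N : ℕ) (hN : 1 ≤ N) (k : ℕ) :
    ∃ C : ℝ, 0 < C ∧ ∀ (p : ℝ≥0∞) [Fact (1 ≤ p)] (s : ℝ), 0 < s → s < 1 →
      ∀ u : (Fin N → ℝ) → ℝ, FracTV.MemSV k s u →
        FracTV.TV p 0 s u ≤
          ENNReal.ofReal C *
            (eLpNorm u 1 (volume.restrict (FracTV.unitCube N)) + FracTV.TV p k s u) := by
  obtain ⟨C, hC, h⟩ := proposition4p9_general N k
  exact ⟨C, hC, fun p _ s hs0 hs u hu =>
    have ⟨_, _, _, hint, _⟩ := hu p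
    h p s hs0.le hs u hint⟩
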